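/- Let $\mathcal H$ be a finite-dimensional complex Hilbert space of dimension $d$, and let $\mathcal P(\mathcal H)\cong\mathbb{CP}^{d-1}$ be its projective space, the set of complex lines $[\psi]$ spanned by nonzero vectors $\psi\in\mathcal H$, with its usual structure of a smooth manifold. The Fubini--Study metric $g_{\mathrm{FS}}$ is the Riemannian metric on $\mathcal P(\mathcal H)$ such that, for every unit vector $\psi\in\mathcal H$ and all $\xi,\eta\in\mathcal H$, \[ g_{\mathrm{FS},[\psi]}\big(d\pi_\psi\xi,\,d\pi_\psi\eta\big)=\operatorname{Re}\big(\langle\xi,\eta\rangle-\langle\xi,\psi\rangle\langle\psi,\eta\rangle\big), \] where $\pi:\mathcal H\setminus\{0\}\to\mathcal P(\mathcal H)$, $\pi(\psi)=[\psi]$, and the inner product is linear in its second argument. Then $g_{\mathrm{FS}}$ is invariant under the unitary group of $\mathcal H$, which acts by $U[\psi]=[U\psi]$; and every smooth Riemannian metric $g$ on $\mathcal P(\mathcal H)$ that is invariant under the unitary group is of the form $g=c\,g_{\mathrm{FS}}$ for some constant $c>0$. -/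

import Mathlib

open scoped LinearAlgebra.Projectivization Manifold ContDiff InnerProductSpace Topology
open Module

noncomputable section

namespace ProjectiveHilbert

variable (H : Type*) [NormedAddCommGroup H] [InnerProductSpace ℂ H]

/-- The space `ℂ^(d-1)`, `d = dim H`, on which the projective space of `H` is modelled. -/
abbrev Model : Type := EuclideanSpace ℂ (Fin (finrank ℂ H - 1))

variable {H}

/-- The quotient topology of `H ∖ {0}`. -/
instance : TopologicalSpace (ℙ ℂ H) :=
  TopologicalSpace.coinduced (Projectivization.mk' ℂ) inferInstance

theorem isQuotientMap_mk' :
    Topology.IsQuotientMap (Projectivization.mk' ℂ : {v : H // v ≠ 0} → ℙ ℂ H) :=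
  ⟨⟨rfl⟩, Quotient.mk''_surjective⟩

/-- A unit vector on the line `p`. -/
def unitRep (p : ℙ ℂ H) : H := ((‖p.rep‖ : ℂ)⁻¹) • p.rep

theorem norm_unitRep (p : ℙ ℂ H) : ‖unitRep p‖ = 1 := by
  have := norm_ne_zero_iff.2 p.rep_nonzero
  simp [unitRep, norm_smul, this]

theorem unitRep_ne_zero (p : ℙ ℂ H) : unitRep p ≠ 0 :=
  norm_ne_zero_iff.1 (by simp [norm_unitRep])

theorem mk_unitRep (p : ℙ ℂ H) : Projectivization.mk ℂ (unitRep p) (unitRep_ne_zero p) = p := by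
  conv_rhs => rw [← p.mk_rep]
  exact (Projectivization.mk_eq_mk_iff' ℂ _ _ _ _).2 ⟨_, rfl⟩

theorem inner_unitRep_self (p : ℙ ℂ H) : ⟪unitRep p, unitRep p⟫_ℂ = 1 := by
  simp [inner_self_eq_norm_sq_to_K, norm_unitRep]

theorem inner_rep_mk_ne_zero_iff (p : ℙ ℂ H) (χ : H) (hχ : χ ≠ 0) :
    ⟪unitRep p, (Projectivization.mk ℂ χ hχ).rep⟫_ℂ ≠ 0 ↔ ⟪unitRep p, χ⟫_ℂ ≠ 0 := by
  obtain ⟨a, ha⟩ := Projectivization.exists_smul_eq_mk_rep ℂ χ hχ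
  rw [← ha, Units.smul_def, inner_smul_right]
  simp

theorem isOpen_source (p : ℙ ℂ H) : IsOpen {q : ℙ ℂ H | ⟪unitRep p, q.rep⟫_ℂ ≠ 0} := by
  rw [← isQuotientMap_mk'.isOpen_preimage]
  have : (Projectivization.mk' ℂ ⁻¹' {q : ℙ ℂ H | ⟪unitRep p, q.rep⟫_ℂ ≠ 0}) =
      {v : {v : H // v ≠ 0} | ⟪unitRep p, v.1⟫_ℂ ≠ 0} := by
    ext v
    exact inner_rep_mk_ne_zero_iff p v.1 v.2
  rw [this]
  exact isOpen_ne_fun (by fun_prop) continuous_const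

/-- The Fubini-Study form `Re (⟨ξ, η⟩ - ⟨ξ, ψ⟩⟨ψ, η⟩)` at a unit vector `ψ`: the real bilinear form
with quadratic form `⟨ξ, ξ⟩ - |⟨ψ, ξ⟩|²`. -/
def fsForm (ψ ξ η : H) : ℝ := (⟪ξ, η⟫_ℂ - ⟪ξ, ψ⟫_ℂ * ⟪ψ, η⟫_ℂ).re

variable [FiniteDimensional ℂ H]

theorem finrank_orthogonal_unitRep (p : ℙ ℂ H) :
    finrank ℂ (ℂ ∙ unitRep p)ᗮ = finrank ℂ H - 1 := by
  have h := Submodule.finrank_add_finrank_orthogonal (ℂ ∙ unitRep p)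
  rw [finrank_span_singleton (unitRep_ne_zero p)] at h
  omega

/-- A linear isometry from the model space onto the orthogonal complement of the line `p`. -/
def lift (p : ℙ ℂ H) : Model H →L[ℂ] H :=
  (ℂ ∙ unitRep p)ᗮ.subtypeL ∘L
    (((stdOrthonormalBasis ℂ (ℂ ∙ unitRep p)ᗮ).reindex
      (finCongr (finrank_orthogonal_unitRep p))).repr.symm : Model H →L[ℂ] (ℂ ∙ unitRep p)ᗮ)

/-- The adjoint of `lift p`. -/
def colift (p : ℙ ℂ H) : H →L[ℂ] Model H := ContinuousLinearMap.adjoint (lift p)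

theorem inner_unitRep_lift (p : ℙ ℂ H) (z : Model H) : ⟪unitRep p, lift p z⟫_ℂ = 0 :=
  Submodule.mem_orthogonal_singleton_iff_inner_right.1 (Subtype.property _)

theorem inner_lift_lift (p : ℙ ℂ H) (z w : Model H) : ⟪lift p z, lift p w⟫_ℂ = ⟪z, w⟫_ℂ := by
  change ⟪(_ : (ℂ ∙ unitRep p)ᗮ), _⟫_ℂ = _
  exact LinearIsometryEquiv.inner_map_map _ z w

theorem colift_lift (p : ℙ ℂ H) (z : Model H) : colift p (lift p z) = z :=
  ext_inner_left ℂ fun w => by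
    rw [colift, ContinuousLinearMap.adjoint_inner_right, inner_lift_lift]

theorem colift_unitRep (p : ℙ ℂ H) : colift p (unitRep p) = 0 :=
  ext_inner_left ℂ fun w => by
    rw [colift, ContinuousLinearMap.adjoint_inner_right, inner_zero_right, ← inner_conj_symm,
      inner_unitRep_lift, map_zero]

theorem decomp (p : ℙ ℂ H) (χ : H) :
    ⟪unitRep p, χ⟫_ℂ • unitRep p + lift p (colift p χ) = χ := by
  have h : χ - ⟪unitRep p, χ⟫_ℂ • unitRep p ∈ (ℂ ∙ unitRep p)ᗮ := by
    rw [Submodule.mem_orthogonal_singleton_iff_inner_right, inner_sub_right, inner_smul_right,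
      inner_unitRep_self, mul_one, sub_self]
  obtain ⟨z, hz⟩ : ∃ z, lift p z = χ - ⟪unitRep p, χ⟫_ℂ • unitRep p := by
    refine ⟨((stdOrthonormalBasis ℂ (ℂ ∙ unitRep p)ᗮ).reindex
      (finCongr (finrank_orthogonal_unitRep p))).repr ⟨_, h⟩, ?_⟩
    simp [lift]
  have h2 : colift p χ = z := by
    rw [← colift_lift p z, hz, map_sub, map_smul, colift_unitRep, smul_zero, sub_zero]
  rw [h2, hz, add_sub_cancel]

/-- The affine coordinate `ψ ↦ ⟨p, ψ⟩⁻¹ • (orthogonal projection of ψ to p^⊥)`. -/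
def coord (p : ℙ ℂ H) (χ : H) : Model H := (⟪unitRep p, χ⟫_ℂ)⁻¹ • colift p χ

theorem coord_smul (p : ℙ ℂ H) {a : ℂ} (ha : a ≠ 0) (χ : H) : coord p (a • χ) = coord p χ := by
  simp only [coord, inner_smul_right, map_smul, smul_smul, mul_inv]
  congr 1
  field_simp

theorem coord_rep_mk (p : ℙ ℂ H) (χ : H) (hχ : χ ≠ 0) :
    coord p (Projectivization.mk ℂ χ hχ).rep = coord p χ := by
  obtain ⟨a, ha⟩ := Projectivization.exists_smul_eq_mk_rep ℂ χ hχ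
  rw [← ha, Units.smul_def, coord_smul p a.ne_zero]

theorem inner_unitRep_affine (p : ℙ ℂ H) (z : Model H) :
    ⟪unitRep p, unitRep p + lift p z⟫_ℂ = 1 := by
  rw [inner_add_right, inner_unitRep_lift, inner_unitRep_self, add_zero]

theorem affine_ne_zero (p : ℙ ℂ H) (z : Model H) : unitRep p + lift p z ≠ 0 := fun h => by
  simpa [h] using inner_unitRep_affine p z

theorem coord_affine (p : ℙ ℂ H) (z : Model H) : coord p (unitRep p + lift p z) = z := by
  rw [coord, inner_unitRep_affine, inv_one, one_smul, map_add, colift_unitRep, colift_lift, zero_add]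

theorem affine_coord (p : ℙ ℂ H) (χ : H) (h : ⟪unitRep p, χ⟫_ℂ ≠ 0) :
    ⟪unitRep p, χ⟫_ℂ • (unitRep p + lift p (coord p χ)) = χ := by
  rw [coord, map_smul, smul_add, smul_smul, mul_inv_cancel₀ h, one_smul, decomp]

theorem contDiffAt_coord (p : ℙ ℂ H) (χ : H) (h : ⟪unitRep p, χ⟫_ℂ ≠ 0) :
    ContDiffAt ℝ ∞ (coord p) χ := by
  have h1 : ContDiffAt ℂ ∞ (coord p) χ := by
    unfold coord
    exact ((innerSL ℂ (unitRep p)).contDiff.contDiffAt.inv h).smul (colift p).contDiff.contDiffAt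
  exact h1.restrict_scalars ℝ

/-- The affine chart centred at `p`: its inverse is `z ↦ [ψ + z]` with `ψ` a unit vector on the
line `p` and `z` in the orthogonal complement of `p`. -/
def affineChart (p : ℙ ℂ H) : OpenPartialHomeomorph (ℙ ℂ H) (Model H) where
  toFun q := coord p q.rep
  invFun z := Projectivization.mk ℂ (unitRep p + lift p z) (affine_ne_zero p z)
  source := {q | ⟪unitRep p, q.rep⟫_ℂ ≠ 0}
  target := Set.univ
  map_source' _ _ := Set.mem_univ _
  map_target' z _ := by
    rw [Set.mem_ofPred_eq, inner_rep_mk_ne_zero_iff, inner_unitRep_affine]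
    exact one_ne_zero
  left_inv' q hq := by
    conv_rhs => rw [← q.mk_rep]
    exact ((Projectivization.mk_eq_mk_iff' ℂ _ _ _ _).2 ⟨_, affine_coord p q.rep hq⟩).symm
  right_inv' z _ := by rw [coord_rep_mk, coord_affine]
  open_source := isOpen_source p
  open_target := isOpen_univ
  continuousOn_toFun := by
    rw [isQuotientMap_mk'.continuousOn_isOpen_iff (isOpen_source p)]
    intro v hv
    have hv' : ⟪unitRep p, v.1⟫_ℂ ≠ 0 := (inner_rep_mk_ne_zero_iff p v.1 v.2).1 hv
    have h1 : (fun q : ℙ ℂ H => coord p q.rep) ∘ Projectivization.mk' ℂ =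
        fun v : {v : H // v ≠ 0} => coord p v.1 := by
      ext1 v
      exact coord_rep_mk p v.1 v.2
    rw [h1]
    exact (ContinuousAt.comp (f := Subtype.val) (contDiffAt_coord p v.1 hv').continuousAt
      continuous_subtype_val.continuousAt).continuousWithinAt
  continuousOn_invFun := by
    refine Continuous.continuousOn ?_
    exact isQuotientMap_mk'.continuous.comp
      (Continuous.subtype_mk (f := fun z => unitRep p + lift p z) (by fun_prop) (affine_ne_zero p))

instance : ChartedSpace (Model H) (ℙ ℂ H) where
  atlas := Set.range affineChart
  chartAt := affineChart
  mem_chart_source p := by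
    change ⟪unitRep p, p.rep⟫_ℂ ≠ 0
    have h := (inner_rep_mk_ne_zero_iff p (unitRep p) (unitRep_ne_zero p)).2
      (by rw [inner_unitRep_self]; exact one_ne_zero)
    rwa [mk_unitRep] at h
  chart_mem_atlas p := ⟨p, rfl⟩

instance : IsManifold 𝓘(ℝ, Model H) ∞ (ℙ ℂ H) := by
  apply isManifold_of_contDiffOn
  rintro _ _ ⟨p, rfl⟩ ⟨q, rfl⟩ z ⟨⟨-, hz⟩, -⟩
  have hz' : ⟪unitRep q, unitRep p + lift p z⟫_ℂ ≠ 0 :=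
    (inner_rep_mk_ne_zero_iff q _ (affine_ne_zero p z)).1 hz
  refine ContDiffAt.contDiffWithinAt ?_
  have h1 : (𝓘(ℝ, Model H) ∘ (affineChart p).symm ≫ₕ affineChart q ∘ 𝓘(ℝ, Model H).symm) =
      coord q ∘ fun z => unitRep p + lift p z := by
    ext1 w
    exact coord_rep_mk q _ (affine_ne_zero p w)
  rw [h1]
  refine ContDiffAt.comp z (contDiffAt_coord q _ hz') ?_
  exact (contDiff_const.add ((lift p).restrictScalars ℝ).contDiff).contDiffAt


theorem fsForm_lift (p : ℙ ℂ H) (u v : Model H) :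
    fsForm (unitRep p) (lift p u) (lift p v) = (⟪u, v⟫_ℂ).re := by
  rw [fsForm, inner_unitRep_lift, mul_zero, sub_zero, inner_lift_lift]

theorem fsForm_colift (p : ℙ ℂ H) (ξ η : H) :
    (⟪colift p ξ, colift p η⟫_ℂ).re = fsForm (unitRep p) ξ η := by
  rw [← fsForm_lift p]
  have h1 : lift p (colift p ξ) = ξ - ⟪unitRep p, ξ⟫_ℂ • unitRep p :=
    eq_sub_of_add_eq' (decomp p ξ)
  have h2 : lift p (colift p η) = η - ⟪unitRep p, η⟫_ℂ • unitRep p :=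
    eq_sub_of_add_eq' (decomp p η)
  simp only [fsForm, inner_unitRep_lift, mul_zero, sub_zero]
  rw [h1, h2]
  simp only [inner_sub_left, inner_sub_right, inner_smul_left, inner_smul_right,
    inner_unitRep_self, inner_conj_symm]
  congr 1
  ring

/-- The Fubini-Study tensor at `p`. The tangent space at `p` is read in the affine chart centred at
`p`, in which `u` is the tangent vector at `t = 0` of the curve `t ↦ [ψ + t • lift p u]`, with `ψ` a
unit vector on the line `p`; so `lift p u`, which is orthogonal to `ψ`, is the horizontal lift of
`u`. See `fubiniStudy_mfderiv_proj` for the description at any unit vector on the line. -/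
def fsTensor (p : ℙ ℂ H) : Model H →L[ℝ] Model H →L[ℝ] ℝ :=
  (LinearMap.mk₂ ℝ (fun u v : Model H => fsForm (unitRep p) (lift p u) (lift p v))
    (fun u u' v => by simp only [fsForm_lift, inner_add_left, Complex.add_re])
    (fun c u v => by
      rw [fsForm_lift, fsForm_lift, ← Complex.coe_smul c u, inner_smul_left, Complex.conj_ofReal,
        Complex.re_ofReal_mul, smul_eq_mul])
    (fun u v v' => by simp only [fsForm_lift, inner_add_right, Complex.add_re])
    (fun c u v => by
      rw [fsForm_lift, fsForm_lift, ← Complex.coe_smul c v, inner_smul_right,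
        Complex.re_ofReal_mul, smul_eq_mul])).toContinuousBilinearMap

theorem fsTensor_apply (p : ℙ ℂ H) (u v : Model H) :
    fsTensor p u v = fsForm (unitRep p) (lift p u) (lift p v) := rfl

theorem hasFDerivAt_coord (p : ℙ ℂ H) (χ : H) (hχ : χ ≠ 0) (h : Projectivization.mk ℂ χ hχ = p) :
    HasFDerivAt (coord p) (((⟪unitRep p, χ⟫_ℂ)⁻¹ • colift p).restrictScalars ℝ) χ := by
  obtain ⟨a, rfl⟩ : ∃ a : ℂ, a • unitRep p = χ := by
    rw [← Projectivization.mk_eq_mk_iff' ℂ _ _ hχ (unitRep_ne_zero p), mk_unitRep, h]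
  have ha : a ≠ 0 := fun h => hχ (by rw [h, zero_smul])
  have hA : colift p (a • unitRep p) = 0 := by rw [map_smul, colift_unitRep, smul_zero]
  have hl : innerSL ℂ (unitRep p) (a • unitRep p) ≠ 0 := by
    rwa [innerSL_apply_apply, inner_smul_right, inner_unitRep_self, mul_one]
  have h0 : HasFDerivAt (fun x => (innerSL ℂ (unitRep p) x)⁻¹) _ (a • unitRep p) :=
    (hasFDerivAt_inv' hl).comp _ (innerSL ℂ (unitRep p)).hasFDerivAt
  have h1 := h0.smul (colift p).hasFDerivAt
  refine HasFDerivAt.restrictScalars ℝ (h1.congr_fderiv ?_)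
  ext1 ξ
  simp [hA]

theorem fsForm_eq_of_mk (p : ℙ ℂ H) (χ : H) (hχ : χ ≠ 0) (h : Projectivization.mk ℂ χ hχ = p)
    (ξ η : H) :
    fsTensor p ((⟪unitRep p, χ⟫_ℂ)⁻¹ • colift p ξ) ((⟪unitRep p, χ⟫_ℂ)⁻¹ • colift p η) =
      (‖χ‖ ^ 2)⁻¹ * (⟪ξ, η⟫_ℂ - (‖χ‖ ^ 2 : ℝ)⁻¹ * (⟪ξ, χ⟫_ℂ * ⟪χ, η⟫_ℂ)).re := by
  obtain ⟨a, rfl⟩ : ∃ a : ℂ, a • unitRep p = χ := by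
    rw [← Projectivization.mk_eq_mk_iff' ℂ _ _ hχ (unitRep_ne_zero p), mk_unitRep, h]
  have ha : a ≠ 0 := fun h => hχ (by rw [h, zero_smul])
  have hn : (‖a‖ : ℂ) ≠ 0 := by simpa using ha
  rw [fsTensor_apply, fsForm_lift, norm_smul, norm_unitRep, mul_one, inner_smul_left,
    inner_smul_right, inner_smul_right, inner_unitRep_self, mul_one, ← mul_assoc]
  have h1 : (starRingEnd ℂ) a⁻¹ * a⁻¹ = ((‖a‖ ^ 2)⁻¹ : ℝ) := by
    rw [map_inv₀, ← mul_inv, mul_comm, Complex.mul_conj, Complex.normSq_eq_norm_sq]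
    push_cast; rfl
  have h2 : ((‖a‖ ^ 2 : ℝ) : ℂ) = a * (starRingEnd ℂ) a := by
    rw [Complex.mul_conj, Complex.normSq_eq_norm_sq]
  rw [h1, Complex.re_ofReal_mul, fsForm_colift, fsForm]
  congr 3
  rw [inner_smul_right, inner_smul_left, Complex.ofReal_inv, h2]
  have : (starRingEnd ℂ) a ≠ 0 := by simpa using ha
  field_simp

/-- Coordinate expression of the Fubini-Study tensor in the affine chart at `p`. -/
theorem fsTensor_tangentCoordChange (p q : ℙ ℂ H) (hq : q ∈ (affineChart p).source)
    (u v : Model H) :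
    fsTensor q (tangentCoordChange 𝓘(ℝ, Model H) p q q u)
        (tangentCoordChange 𝓘(ℝ, Model H) p q q v) =
      (‖unitRep p + lift p (affineChart p q)‖ ^ 2)⁻¹ * (⟪lift p u, lift p v⟫_ℂ -
        (‖unitRep p + lift p (affineChart p q)‖ ^ 2 : ℝ)⁻¹ *
          (⟪lift p u, unitRep p + lift p (affineChart p q)⟫_ℂ *
            ⟪unitRep p + lift p (affineChart p q), lift p v⟫_ℂ)).re := by
  set z := affineChart p q with hz
  have hm : Projectivization.mk ℂ _ (affine_ne_zero p z) = q := (affineChart p).left_inv hq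
  rw [← fsForm_eq_of_mk q _ (affine_ne_zero p z) hm]
  have h1 : tangentCoordChange 𝓘(ℝ, Model H) p q q =
      (((⟪unitRep q, unitRep p + lift p z⟫_ℂ)⁻¹ • colift q).restrictScalars ℝ) ∘L
        (lift p).restrictScalars ℝ := by
    rw [tangentCoordChange_def]
    simp only [modelWithCornersSelf_coe, Set.range_id, fderivWithin_univ]
    have h2 : (extChartAt 𝓘(ℝ, Model H) q ∘ (extChartAt 𝓘(ℝ, Model H) p).symm) =
        coord q ∘ fun z => unitRep p + lift p z := by
      ext1 w
      exact coord_rep_mk q _ (affine_ne_zero p w)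
    rw [h2]
    refine HasFDerivAt.fderiv ?_
    change HasFDerivAt _ _ z
    exact (hasFDerivAt_coord q _ (affine_ne_zero p z) hm).comp z
      (((lift p).restrictScalars ℝ).hasFDerivAt.const_add _)
  rw [h1]
  rfl

variable (H) in
/-- Smooth Riemannian metrics on the projective space of `H`. -/
abbrev RiemannianMetric : Type _ :=
  Bundle.ContMDiffRiemannianMetric 𝓘(ℝ, Model H) ∞ (Model H)
    (fun p : ℙ ℂ H => TangentSpace 𝓘(ℝ, Model H) p)

theorem contMDiff_fsTensor :
    ContMDiff 𝓘(ℝ, Model H) (𝓘(ℝ, Model H).prod 𝓘(ℝ, Model H →L[ℝ] Model H →L[ℝ] ℝ)) ∞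
    (fun p : ℙ ℂ H => Bundle.TotalSpace.mk' (Model H →L[ℝ] Model H →L[ℝ] ℝ)
      (E := fun p : ℙ ℂ H => TangentSpace 𝓘(ℝ, Model H) p →L[ℝ]
        TangentSpace 𝓘(ℝ, Model H) p →L[ℝ] ℝ) p (fsTensor p)) := by
  intro p
  rw [contMDiffAt_hom_bundle]
  refine ⟨contMDiffAt_id, ?_⟩
  set F : ℙ ℂ H → (Model H →L[ℝ] Model H →L[ℝ] ℝ) := fun q =>
    ContinuousLinearMap.inCoordinates (Model H) (fun p : ℙ ℂ H => TangentSpace 𝓘(ℝ, Model H) p)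
      (Model H →L[ℝ] ℝ) (fun p : ℙ ℂ H => TangentSpace 𝓘(ℝ, Model H) p →L[ℝ] ℝ)
      p q p q (fsTensor q) with hF
  change ContMDiffAt 𝓘(ℝ, Model H) 𝓘(ℝ, Model H →L[ℝ] Model H →L[ℝ] ℝ) ∞ F p
  have key : ∀ q ∈ (affineChart p).source, ∀ u v : Model H, F q u v =
      fsTensor q (tangentCoordChange 𝓘(ℝ, Model H) p q q u)
        (tangentCoordChange 𝓘(ℝ, Model H) p q q v) := by
    intro q hq u v
    have h1 := inCoordinates_apply_eq₂ (𝕜 := ℝ)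
      (F₁ := Model H) (E₁ := fun p : ℙ ℂ H => TangentSpace 𝓘(ℝ, Model H) p)
      (F₂ := Model H) (E₂ := fun p : ℙ ℂ H => TangentSpace 𝓘(ℝ, Model H) p)
      (F₃ := ℝ) (E₃ := Bundle.Trivial (ℙ ℂ H) ℝ)
      (x₀ := p) (x := q) (ϕ := fsTensor q) (v := u) (w := v) hq hq (Set.mem_univ _)
    have h2 := TangentBundle.symmL_trivializationAt_eq_core (I := 𝓘(ℝ, Model H))
      (b₀ := p) (b := q) hq
    have h3 : ∀ w : Model H, (trivializationAt (Model H)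
        (fun p : ℙ ℂ H => TangentSpace 𝓘(ℝ, Model H) p) p).symm q w =
          tangentCoordChange 𝓘(ℝ, Model H) p q q w := fun w => by
      rw [tangentCoordChange, ← h2]
      exact (Bundle.Trivialization.symmL_apply _ hq w).symm
    refine h1.trans ?_
    rw [h3, h3]
    simp
    rfl
  have hG : ContDiff ℝ ∞ (F ∘ (affineChart p).symm) := by
    rw [contDiff_clm_apply_iff]
    intro u
    rw [contDiff_clm_apply_iff]
    intro v
    have h1 : (fun z => (F ∘ (affineChart p).symm) z u v) = fun z =>
        (‖unitRep p + lift p z‖ ^ 2)⁻¹ * (⟪lift p u, lift p v⟫_ℂ -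
          (‖unitRep p + lift p z‖ ^ 2 : ℝ)⁻¹ *
          (⟪lift p u, unitRep p + lift p z⟫_ℂ * ⟪unitRep p + lift p z, lift p v⟫_ℂ)).re := by
      ext1 z
      have hz : (affineChart p).symm z ∈ (affineChart p).source :=
        (affineChart p).map_target (Set.mem_univ z)
      rw [Function.comp_apply, key _ hz, fsTensor_tangentCoordChange p _ hz,
        (affineChart p).right_inv (Set.mem_univ z)]
    rw [h1]
    have hχ : ContDiff ℝ ∞ fun z => unitRep p + lift p z :=
      contDiff_const.add ((lift p).restrictScalars ℝ).contDiff
    have hs : ContDiff ℝ ∞ fun z => (‖unitRep p + lift p z‖ ^ 2)⁻¹ :=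
      (hχ.norm_sq ℂ).inv fun z => pow_ne_zero 2 (norm_ne_zero_iff.2 (affine_ne_zero p z))
    refine hs.mul (Complex.reCLM.contDiff.comp (contDiff_const.sub ?_))
    exact (Complex.ofRealCLM.contDiff.comp hs).mul
      ((contDiff_const.inner ℂ hχ).mul (hχ.inner ℂ contDiff_const))
  have hc : ContMDiffAt 𝓘(ℝ, Model H) 𝓘(ℝ, Model H) ∞ (affineChart p) p :=
    contMDiffAt_extChartAt (I := 𝓘(ℝ, Model H)) (x := p)
  refine (hG.contMDiff.contMDiffAt.comp p hc).congr_of_eventuallyEq ?_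
  filter_upwards [(affineChart p).open_source.mem_nhds (mem_chart_source (Model H) p)] with q hq
  simp only [Function.comp_apply, (affineChart p).left_inv hq]

theorem fsTensor_symm (p : ℙ ℂ H) (u v : Model H) : fsTensor p u v = fsTensor p v u := by
  rw [fsTensor_apply, fsForm_lift, fsTensor_apply, fsForm_lift, ← inner_conj_symm, Complex.conj_re]

theorem fsTensor_self (p : ℙ ℂ H) (u : Model H) : fsTensor p u u = ‖u‖ ^ 2 := by
  rw [fsTensor_apply, fsForm_lift, inner_self_eq_norm_sq_to_K]
  norm_cast

theorem isBounded_fsTensor_lt_one (p : ℙ ℂ H) :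
    Bornology.IsBounded {u : Model H | fsTensor p u u < 1} := by
  refine (Metric.isBounded_ball (x := 0) (r := 1)).subset fun u hu => ?_
  have hu' : fsTensor p u u < 1 := hu
  rw [fsTensor_self] at hu'
  rw [Metric.mem_ball, dist_zero_right]
  exact (sq_lt_one_iff₀ (norm_nonneg _)).1 hu'

/-- The Fubini-Study metric on the projective space of `H`. -/
def fubiniStudy : RiemannianMetric H where
  inner p := fsTensor p
  symm p u v := fsTensor_symm p u v
  pos p u hu := (pow_pos (norm_pos_iff.2 hu) 2).trans_eq (fsTensor_self p u).symm
  isVonNBounded p := NormedSpace.isVonNBounded_of_isBounded ℝ (isBounded_fsTensor_lt_one p)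
  contMDiff := contMDiff_fsTensor

/-- The space of nonzero vectors, as an open submanifold of `H`. -/
def nonzero (H : Type*) [NormedAddCommGroup H] : TopologicalSpace.Opens H :=
  ⟨{0}ᶜ, isOpen_compl_singleton⟩

/-- The canonical projection `ψ ↦ [ψ]`. -/
def proj (ψ : nonzero H) : ℙ ℂ H := Projectivization.mk ℂ ψ.1 ψ.2

theorem hasMFDerivAt_proj (ψ : nonzero H) :
    HasMFDerivAt 𝓘(ℝ, H) 𝓘(ℝ, Model H) (proj : nonzero H → ℙ ℂ H) ψ
      (((⟪unitRep (proj ψ), ψ.1⟫_ℂ)⁻¹ • colift (proj ψ)).restrictScalars ℝ) := by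
  refine ⟨isQuotientMap_mk'.continuous.continuousAt, ?_⟩
  have h1 : extChartAt 𝓘(ℝ, H) ψ ψ = ψ.1 := rfl
  rw [h1]
  refine HasFDerivAt.hasFDerivWithinAt ?_
  refine (hasFDerivAt_coord (proj ψ) ψ.1 ψ.2 rfl).congr_of_eventuallyEq ?_
  filter_upwards [(nonzero H).isOpen.mem_nhds ψ.2] with χ hχ
  have h2 : (extChartAt 𝓘(ℝ, H) ψ).symm χ = ⟨χ, hχ⟩ := by
    have h3 := (extChartAt 𝓘(ℝ, H) ψ).left_inv (x := ⟨χ, hχ⟩) (by simp [chartAt_self_eq, TopologicalSpace.Opens.chartAt_eq])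
    exact h3
  simp only [writtenInExtChartAt, Function.comp_apply, h2]
  exact coord_rep_mk _ χ hχ

/-- The Fubini-Study metric at `[ψ]`, for any unit vector `ψ`, is the form `fsForm ψ` on the
velocities `ξ`, `η` of lifts to `H ∖ {0}`. -/
theorem fubiniStudy_mfderiv_proj (ψ : nonzero H) (hψ : ‖ψ.1‖ = 1) (ξ η : H) :
    fubiniStudy.inner (proj ψ) (mfderiv 𝓘(ℝ, H) 𝓘(ℝ, Model H) (proj : nonzero H → ℙ ℂ H) ψ ξ)
      (mfderiv 𝓘(ℝ, H) 𝓘(ℝ, Model H) (proj : nonzero H → ℙ ℂ H) ψ η) = fsForm ψ.1 ξ η := by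
  rw [(hasMFDerivAt_proj ψ).mfderiv]
  refine (fsForm_eq_of_mk (proj ψ) ψ.1 ψ.2 rfl ξ η).trans ?_
  simp [hψ, fsForm]

/-- The action of a unitary operator on the projective space, `[ψ] ↦ [U ψ]`. -/
def unitaryAct (U : H ≃ₗᵢ[ℂ] H) : ℙ ℂ H → ℙ ℂ H :=
  Projectivization.map (U.toLinearEquiv : H →ₗ[ℂ] H) U.injective

/-- Invariance under the unitary group: every unitary operator acts by isometries of `g`. -/
def UnitarilyInvariant (g : RiemannianMetric H) : Prop :=
  ∀ (U : H ≃ₗᵢ[ℂ] H) (p : ℙ ℂ H) (u v : TangentSpace 𝓘(ℝ, Model H) p),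
    g.inner (unitaryAct U p)
        (mfderiv 𝓘(ℝ, Model H) 𝓘(ℝ, Model H) (unitaryAct U) p u)
        (mfderiv 𝓘(ℝ, Model H) 𝓘(ℝ, Model H) (unitaryAct U) p v) =
      g.inner p u v

end ProjectiveHilbert

end

/-!
Unitary operators act transitively on pairs of orthogonal vectors of prescribed lengths, because two
families with the same Gram matrix differ by a unitary operator. Applied to a unit vector `ψ` on a
line `p` and to the horizontal lift of a tangent vector at `p`, this says that the unitary group
acts transitively on the tangent vectors of a given Fubini-Study length. An invariant symmetric form
is therefore, at all points at once, the same function of that length, and its homogeneity and the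
polarization identity leave one constant free.
-/

section InnerProductSpace

variable {𝕜 V : Type*} [RCLike 𝕜] [NormedAddCommGroup V] [InnerProductSpace 𝕜 V]

theorem norm_linearCombination_eq_of_inner_eq {ι W : Type*} [NormedAddCommGroup W]
    [InnerProductSpace 𝕜 W] {v : ι → V} {w : ι → W}
    (h : ∀ i j, ⟪v i, v j⟫_𝕜 = ⟪w i, w j⟫_𝕜) (l : ι →₀ 𝕜) :
    ‖Finsupp.linearCombination 𝕜 v l‖ = ‖Finsupp.linearCombination 𝕜 w l‖ := by
  simp only [@norm_eq_sqrt_re_inner 𝕜, Finsupp.linearCombination_apply, Finsupp.sum_inner,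
    Finsupp.inner_sum, inner_smul_left, inner_smul_right, h]

variable [FiniteDimensional 𝕜 V]

theorem exists_linearIsometryEquiv_apply_eq_of_norm_eq {E : Type*} [AddCommGroup E] [Module 𝕜 E]
    {f g : E →ₗ[𝕜] V} (h : ∀ x, ‖f x‖ = ‖g x‖) :
    ∃ U : V ≃ₗᵢ[𝕜] V, ∀ x, U (f x) = g x := by
  obtain ⟨r, hr⟩ := f.rangeRestrict.exists_rightInverse_of_surjective f.range_rangeRestrict
  have hfr (y : LinearMap.range f) : f (r y) = y := congrArg Subtype.val (LinearMap.congr_fun hr y)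
  let L : LinearMap.range f →ₗᵢ[𝕜] V :=
    ⟨g ∘ₗ r, fun y => by rw [LinearMap.comp_apply, ← h, hfr, Submodule.coe_norm]⟩
  refine ⟨L.extend.toLinearIsometryEquiv rfl, fun x => ?_⟩
  have hgr : g (r (f.rangeRestrict x)) = g x := by
    rw [← sub_eq_zero, ← map_sub, ← norm_eq_zero, ← h, map_sub, hfr, LinearMap.codRestrict_apply,
      sub_self, norm_zero]
  exact (L.extend_apply (f.rangeRestrict x)).trans hgr

theorem exists_linearIsometryEquiv_apply_eq_of_inner_eq {ι : Type*} {v w : ι → V}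
    (h : ∀ i j, ⟪v i, v j⟫_𝕜 = ⟪w i, w j⟫_𝕜) : ∃ U : V ≃ₗᵢ[𝕜] V, ∀ i, U (v i) = w i := by
  obtain ⟨U, hU⟩ := exists_linearIsometryEquiv_apply_eq_of_norm_eq
    (norm_linearCombination_eq_of_inner_eq h)
  exact ⟨U, fun i => by simpa using hU (Finsupp.single i 1)⟩

end InnerProductSpace

namespace ProjectiveHilbert

variable {H : Type*} [NormedAddCommGroup H] [InnerProductSpace ℂ H]

theorem fsForm_map {H' : Type*} [NormedAddCommGroup H'] [InnerProductSpace ℂ H']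
    (U : H →ₗᵢ[ℂ] H') (ψ ξ η : H) : fsForm (U ψ) (U ξ) (U η) = fsForm ψ ξ η := by
  simp only [fsForm, LinearIsometry.inner_map_map]

section unitaryAct

variable (U : H ≃ₗᵢ[ℂ] H) (p : ℙ ℂ H)

theorem unitaryAct_mk {χ : H} (hχ : χ ≠ 0) :
    unitaryAct U (Projectivization.mk ℂ χ hχ) =
      Projectivization.mk ℂ (U χ) ((map_ne_zero_iff U U.injective).2 hχ) := rfl

theorem map_unitRep_ne_zero : U (unitRep p) ≠ 0 :=
  (map_ne_zero_iff U U.injective).2 (unitRep_ne_zero p)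

theorem mk_map_unitRep :
    Projectivization.mk ℂ (U (unitRep p)) (map_unitRep_ne_zero U p) = unitaryAct U p := by
  rw [← unitaryAct_mk U (unitRep_ne_zero p), mk_unitRep]

theorem continuous_unitaryAct : Continuous (unitaryAct U) := by
  rw [isQuotientMap_mk'.continuous_iff]
  exact isQuotientMap_mk'.continuous.comp <|
    (U.continuous.comp continuous_subtype_val).subtype_mk fun v =>
      (map_ne_zero_iff U U.injective).2 v.2

variable [FiniteDimensional ℂ H]

theorem extChartAt_self_eq_zero : extChartAt 𝓘(ℝ, Model H) p p = 0 :=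
  calc coord p p.rep
      = coord p (Projectivization.mk ℂ (unitRep p) (unitRep_ne_zero p)).rep := by rw [mk_unitRep]
    _ = coord p (unitRep p) := coord_rep_mk p _ _
    _ = 0 := by rw [coord, colift_unitRep, smul_zero]

theorem writtenInExtChartAt_unitaryAct :
    writtenInExtChartAt 𝓘(ℝ, Model H) 𝓘(ℝ, Model H) p (unitaryAct U) =
      fun z => coord (unitaryAct U p) (U (unitRep p + lift p z)) :=
  funext fun z => coord_rep_mk (unitaryAct U p) _
    ((map_ne_zero_iff U U.injective).2 (affine_ne_zero p z))

theorem hasMFDerivAt_unitaryAct :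
    HasMFDerivAt 𝓘(ℝ, Model H) 𝓘(ℝ, Model H) (unitaryAct U) p
      (((⟪unitRep (unitaryAct U p), U (unitRep p)⟫_ℂ)⁻¹ •
        (colift (unitaryAct U p) ∘L (U : H →L[ℂ] H) ∘L lift p)).restrictScalars ℝ :
          Model H →L[ℝ] Model H) := by
  refine ⟨(continuous_unitaryAct U).continuousAt, HasFDerivAt.hasFDerivWithinAt ?_⟩
  rw [extChartAt_self_eq_zero, writtenInExtChartAt_unitaryAct]
  have hχ : U (unitRep p + lift p 0) = U (unitRep p) := by rw [map_zero, add_zero]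
  have h_affine : HasFDerivAt (fun z => U (unitRep p + lift p z))
      (((U : H →L[ℂ] H) ∘L lift p).restrictScalars ℝ) (0 : Model H) :=
    ((U : H →L[ℂ] H).restrictScalars ℝ).hasFDerivAt.comp _
      (((lift p).restrictScalars ℝ).hasFDerivAt.const_add _)
  have h_coord :=
    hasFDerivAt_coord (unitaryAct U p) _ (map_unitRep_ne_zero U p) (mk_map_unitRep U p)
  rw [← hχ] at h_coord
  refine (h_coord.comp (0 : Model H) h_affine).congr_fderiv ?_
  rw [hχ]
  rfl

theorem mfderiv_unitaryAct_apply (u : TangentSpace 𝓘(ℝ, Model H) p) :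
    mfderiv 𝓘(ℝ, Model H) 𝓘(ℝ, Model H) (unitaryAct U) p u =
      ((⟪unitRep (unitaryAct U p), U (unitRep p)⟫_ℂ)⁻¹ •
        colift (unitaryAct U p) (U (lift p u)) : Model H) := by
  rw [(hasMFDerivAt_unitaryAct U p).mfderiv]
  rfl

theorem fsTensor_mfderiv_unitaryAct (u v : TangentSpace 𝓘(ℝ, Model H) p) :
    fsTensor (unitaryAct U p) (mfderiv 𝓘(ℝ, Model H) 𝓘(ℝ, Model H) (unitaryAct U) p u)
        (mfderiv 𝓘(ℝ, Model H) 𝓘(ℝ, Model H) (unitaryAct U) p v) =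
      fsForm (U (unitRep p)) (U (lift p u)) (U (lift p v)) := by
  rw [mfderiv_unitaryAct_apply, mfderiv_unitaryAct_apply,
    fsForm_eq_of_mk _ _ (map_unitRep_ne_zero U p) (mk_map_unitRep U p), U.norm_map, norm_unitRep]
  simp [fsForm]

end unitaryAct

variable [FiniteDimensional ℂ H]

theorem unitarilyInvariant_fubiniStudy : UnitarilyInvariant (fubiniStudy (H := H)) :=
  fun U p u v => (fsTensor_mfderiv_unitaryAct U p u v).trans (fsForm_map U.toLinearIsometry _ _ _)

theorem exists_unitary_unitRep_lift (p q : ℙ ℂ H) {u v : Model H} (h : ‖u‖ = ‖v‖) :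
    ∃ U : H ≃ₗᵢ[ℂ] H, U (unitRep p) = unitRep q ∧ U (lift p u) = lift q v := by
  have h_inner : ⟪u, u⟫_ℂ = ⟪v, v⟫_ℂ := by simp only [inner_self_eq_norm_sq_to_K, h]
  have inner_lift_unitRep (r : ℙ ℂ H) (z : Model H) : ⟪lift r z, unitRep r⟫_ℂ = 0 :=
    inner_eq_zero_symm.1 (inner_unitRep_lift r z)
  have h_gram : ∀ i j, ⟪![unitRep p, lift p u] i, ![unitRep p, lift p u] j⟫_ℂ =
      ⟪![unitRep q, lift q v] i, ![unitRep q, lift q v] j⟫_ℂ := by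
    simp only [Fin.forall_fin_two, Matrix.cons_val_zero, Matrix.cons_val_one, inner_unitRep_self,
      inner_unitRep_lift, inner_lift_unitRep, inner_lift_lift, h_inner, and_self]
  obtain ⟨U, hU⟩ := exists_linearIsometryEquiv_apply_eq_of_inner_eq h_gram
  exact ⟨U, hU 0, hU 1⟩

theorem exists_tangentMap_unitaryAct_eq {p q : ℙ ℂ H} {u : TangentSpace 𝓘(ℝ, Model H) p}
    {v : TangentSpace 𝓘(ℝ, Model H) q} (h : fubiniStudy.inner p u u = fubiniStudy.inner q v v) :
    ∃ U : H ≃ₗᵢ[ℂ] H,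
      tangentMap 𝓘(ℝ, Model H) 𝓘(ℝ, Model H) (unitaryAct U) ⟨p, u⟩ = ⟨q, v⟩ := by
  have h_norm : norm (E := Model H) u = norm (E := Model H) v :=
    (sq_eq_sq₀ (norm_nonneg _) (norm_nonneg _)).1 <|
      (fsTensor_self p u).symm.trans (h.trans (fsTensor_self q v))
  obtain ⟨U, h_unitRep, h_lift⟩ := exists_unitary_unitRep_lift p q h_norm
  obtain rfl : unitaryAct U p = q := by
    simp only [← mk_map_unitRep, h_unitRep, mk_unitRep]
  have h_mfderiv : mfderiv 𝓘(ℝ, Model H) 𝓘(ℝ, Model H) (unitaryAct U) p u = v := by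
    rw [mfderiv_unitaryAct_apply, h_unitRep, h_lift, inner_unitRep_self, inv_one, one_smul]
    exact colift_lift _ _
  exact ⟨U, congrArg (Bundle.TotalSpace.mk _) h_mfderiv⟩

theorem exists_fubiniStudy_inner_self_eq_one [Nontrivial (Model H)] (p : ℙ ℂ H) :
    ∃ e, fubiniStudy.inner p e e = 1 := by
  obtain ⟨e, he⟩ := exists_norm_eq (Model H) zero_le_one
  exact ⟨e, (fsTensor_self p e).trans (by rw [he, one_pow])⟩

variable (H) in
/-- Fields of bilinear forms on the tangent spaces of the projective space of `H`, without any
regularity in the base point. -/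
abbrev BilinField : Type _ :=
  ∀ p : ℙ ℂ H, TangentSpace 𝓘(ℝ, Model H) p →L[ℝ] TangentSpace 𝓘(ℝ, Model H) p →L[ℝ] ℝ

namespace BilinField

/-- Invariance of a field of bilinear forms under pullback by every unitary operator. For a
Riemannian metric `g`, the proposition `UnitarilyInvariant g` unfolds to
`BilinField.IsUnitarilyInvariant g.inner`. -/
def IsUnitarilyInvariant (B : BilinField H) : Prop :=
  ∀ (U : H ≃ₗᵢ[ℂ] H) (p : ℙ ℂ H) (u v : TangentSpace 𝓘(ℝ, Model H) p),
    B (unitaryAct U p)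
        (mfderiv 𝓘(ℝ, Model H) 𝓘(ℝ, Model H) (unitaryAct U) p u)
        (mfderiv 𝓘(ℝ, Model H) 𝓘(ℝ, Model H) (unitaryAct U) p v) =
      B p u v

variable {B : BilinField H}

theorem IsUnitarilyInvariant.apply_self_eq (hB : B.IsUnitarilyInvariant) {p q : ℙ ℂ H}
    {u : TangentSpace 𝓘(ℝ, Model H) p} {v : TangentSpace 𝓘(ℝ, Model H) q}
    (h : fubiniStudy.inner p u u = fubiniStudy.inner q v v) : B p u u = B q v v := by
  obtain ⟨U, ⟨⟩⟩ := exists_tangentMap_unitaryAct_eq h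
  exact (hB U p u u).symm

theorem IsUnitarilyInvariant.apply_self_eq_mul (hB : B.IsUnitarilyInvariant) {p : ℙ ℂ H}
    {e : TangentSpace 𝓘(ℝ, Model H) p} (he : fubiniStudy.inner p e e = 1) (q : ℙ ℂ H)
    (u : TangentSpace 𝓘(ℝ, Model H) q) : B q u u = B p e e * fubiniStudy.inner q u u := by
  obtain ⟨r, hr⟩ : ∃ r : ℝ, r * r = fubiniStudy.inner q u u :=
    ⟨norm (E := Model H) u, (sq _).symm.trans (fsTensor_self q u).symm⟩
  have h_smul (A : BilinField H) : A p (r • e) (r • e) = r * r * A p e e := by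
    simp only [map_smul, smul_apply, smul_eq_mul, mul_assoc]
  have h_length : fubiniStudy.inner q u u = fubiniStudy.inner p (r • e) (r • e) := by
    rw [h_smul fubiniStudy.inner, he, mul_one, hr]
  rw [hB.apply_self_eq h_length, h_smul, hr, mul_comm]

theorem IsUnitarilyInvariant.apply_eq_mul (hB : B.IsUnitarilyInvariant)
    (h_symm : ∀ p u v, B p u v = B p v u) {p : ℙ ℂ H} {e : TangentSpace 𝓘(ℝ, Model H) p}
    (he : fubiniStudy.inner p e e = 1) (q : ℙ ℂ H) (u v : TangentSpace 𝓘(ℝ, Model H) q) :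
    B q u v = B p e e * fubiniStudy.inner q u v := by
  have hB_symm : LinearMap.BilinForm.IsSymm (B q).toBilinForm := ⟨h_symm q⟩
  have hFS_symm : LinearMap.BilinForm.IsSymm
      (B p e e • (fubiniStudy.inner q).toBilinForm) :=
    ⟨fun u v => congrArg (B p e e * ·) (fubiniStudy.symm q u v)⟩
  exact LinearMap.congr_fun₂ (LinearMap.BilinForm.ext_of_isSymm hB_symm hFS_symm
    (hB.apply_self_eq_mul he q)) u v

end BilinField

end ProjectiveHilbert

open ProjectiveHilbert in
theorem mainTheorem2_general {H : Type*} [NormedAddCommGroup H] [InnerProductSpace ℂ H]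
    [FiniteDimensional ℂ H] :
    UnitarilyInvariant (fubiniStudy (H := H)) ∧
    ∀ B : BilinField H, (∀ p u v, B p u v = B p v u) → B.IsUnitarilyInvariant →
      ∃ c : ℝ, (∀ p u v, B p u v = c * fubiniStudy.inner p u v) ∧
        ((∀ p u, u ≠ 0 → 0 < B p u u) → 0 < c) := by
  refine ⟨unitarilyInvariant_fubiniStudy, fun B h_symm hB => ?_⟩
  rcases subsingleton_or_nontrivial (Model H) with _ | _
  · refine ⟨1, fun p u v => ?_, fun _ => one_pos⟩
    have hu : u = 0 := Subsingleton.elim (α := Model H) u 0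
    simp only [hu, map_zero, zero_apply, mul_zero]
  rcases isEmpty_or_nonempty (ℙ ℂ H) with _ | ⟨⟨p⟩⟩
  · exact ⟨1, fun p => isEmptyElim p, fun _ => one_pos⟩
  obtain ⟨e, he⟩ := exists_fubiniStudy_inner_self_eq_one p
  have he0 : e ≠ 0 := fun h => by simp [h] at he
  exact ⟨B p e e, hB.apply_eq_mul h_symm he, fun h_pos => h_pos p e he0⟩

theorem mainTheorem2 {H : Type*} [NormedAddCommGroup H] [InnerProductSpace ℂ H]
    [FiniteDimensional ℂ H] :
    ProjectiveHilbert.UnitarilyInvariant (ProjectiveHilbert.fubiniStudy (H := H)) ∧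
    ∀ g : ProjectiveHilbert.RiemannianMetric H, ProjectiveHilbert.UnitarilyInvariant g →
      ∃ c : ℝ, 0 < c ∧ ∀ (p : ℙ ℂ H) (u v : TangentSpace 𝓘(ℝ, ProjectiveHilbert.Model H) p),
        g.inner p u v = c * ProjectiveHilbert.fubiniStudy.inner p u v :=
  ⟨mainTheorem2_general.1, fun g hg =>
    let ⟨c, hc, h_pos⟩ := mainTheorem2_general.2 g.inner g.symm hg; ⟨c, h_pos g.pos, hc⟩⟩
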